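/- Let $\mathbb{T}^+$ be either $\mathbb{N}\cup\{0\}$ or $[0,\infty)$ and let $(X,d)$ be a non-empty compact metric space. Let $(\Omega,\mathcal{F},(\mathcal{F}_t)_{t\in\mathbb{T}^+},\mathbb{P},(\theta^t)_{t\in\mathbb{T}^+})$ be a memoryless noise space: $(\Omega,\mathcal{F},\mathbb{P})$ is a probability space with a filtration $(\mathcal{F}_t)$; $\theta^t:\Omega\to\Omega$ are $\mathcal{F}$-measurable, $\mathbb{P}$-preserving maps with $\theta^0=\mathrm{id}$ and $\theta^{s+t}=\theta^s\circ\theta^t$, and $\theta^t$ is measurable from $(\Omega,\mathcal{F}_{s+t})$ to $(\Omega,\mathcal{F}_s)$ for all $s,t$; and, with $\mathcal{F}_\infty=\sigma(\mathcal{F}_t:t\in\mathbb{T}^+)$, the $\sigma$-algebras $\mathcal{F}_s$ and $\theta^{-s}\mathcal{F}_\infty$ are $\mathbb{P}$-independent for every $s$. Let $\varphi$ be a càdlàg random dynamical system on $X$ over this noise space, that is, a family of continuous maps $\varphi(t,\omega):X\to X$ ($t\in\mathbb{T}^+$, $\omega\in\Omega$) such that: (a) $(\omega,x)\mapsto\varphi(t,\omega)x$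 is $(\mathcal{F}_t\otimes\mathcal{B}(X))$-measurable for each $t$; (b) $\varphi(0,\omega)=\mathrm{id}$; (c) $\varphi(s+t,\omega)=\varphi(t,\theta^s\omega)\circ\varphi(s,\omega)$; (d) if $t_n$ decreases (not necessarily strictly) to $t$ and $x_n\to x$, then $\varphi(t_n,\omega)x_n\to\varphi(t,\omega)x$ for all $\omega$; (e) there is a function $\varphi_-:\mathbb{T}^+\times\Omega\times X\to X$ such that if $t_n$ is strictly increasing with limit $t$ and $x_n\to x$, then $\varphi(t_n,\omega)x_n\to\varphi_-(t,\omega,x)$ for all $\omega$. Definitions. A set $A\subset X$ contracts under $\omega$ if $\mathrm{diam}(\varphi(t,\omega)A)\to0$ as $t\to\infty$. A pair $(\omega,x)$ is asymptotically stable if some neighbourhood of $x$ contracts under $\omega$. The system $\varphi$ is stably synchronising if for all $x,y\in X$ the set $\{x,y\}$ contracts under $\omega$ for $\mathbb{P}$-almost every $\omega$, and for all $x\in X$ the pair $(\omega,x)$ is asymptotically stable for $\mathbb{P}$-almost every $\omega$. A closed set $K\subset X$ is forward-invariant if for $\mathbb{P}$-almost every $\omega$ one has $\varphi(t,\omega)K\subset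 K$ for all $t\in\mathbb{T}^+$. A set $K$ is minimal if it is non-empty, closed and forward-invariant, and its only closed forward-invariant subsets are $K$ and $\emptyset$. The system $\varphi$ is two-point contractible on a closed forward-invariant set $K$ if for all $x,y\in K$ and every open neighbourhood $V\subset X\times X$ of the diagonal $\{(z,z):z\in X\}$, \[\mathbb{P}\big(\omega:\exists\,t\in\mathbb{T}^+\text{ with }(\varphi(t,\omega)x,\varphi(t,\omega)y)\in V\big)>0.\] A closed forward-invariant set $K$ admits stable trajectories if \[\mathbb{P}\big(\omega:\exists\,x\in K\text{ with }(\omega,x)\text{ asymptotically stable}\big)>0.\] Theorem. $\varphi$ is stably synchronising if and only if the following conditions all hold: (i) there is a unique minimal set $K\subset X$; (ii) $\varphi$ is two-point contractible on $K$; (iii) $K$ admits stable trajectories. -/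

import Mathlib

open MeasureTheory Filter Topology Set
open scoped NNReal

/-- A stationary noise space with time set `T`: a filtered probability space `(Ω, F, (F_t), P)` together
with a shift dynamical system `(θ^t)` on it for which `P` is invariant. -/
structure NoiseSpace (T Ω : Type*) [AddMonoid T] [Preorder T] [mΩ : MeasurableSpace Ω] where
  /-- the filtration `(F_t)` -/
  filt : Filtration T mΩ
  /-- the probability measure -/
  P : Measure Ω
  isProbabilityMeasure : IsProbabilityMeasure P
  /-- the time shifts `θ^t` -/
  θ : T → Ω → Ω
  θ_zero : ∀ ω, θ 0 ω = ω
  θ_add : ∀ s t ω, θ (s + t) ω = θ s (θ t ω)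
  /-- each `θ^t` is measurable on `(Ω, F)` and leaves `P` invariant -/
  θ_measurePreserving : ∀ t, MeasurePreserving (θ t) P P
  /-- `θ^t` is measurable from `(Ω, F_{s+t})` to `(Ω, F_s)` -/
  θ_shift : ∀ s t, Measurable[filt (s + t), filt s] (θ t)

namespace NoiseSpace

variable {T Ω : Type*} [AddMonoid T] [Preorder T] [MeasurableSpace Ω]

/-- `F_∞`, the σ-algebra generated by all the `F_t`. -/
abbrev filtInfty (N : NoiseSpace T Ω) : MeasurableSpace Ω := ⨆ t, N.filt t

/-- A noise space is memoryless if for every `s` the σ-algebras `F_s` and `θ^{-s} F_∞` are independent. -/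
def IsMemoryless (N : NoiseSpace T Ω) : Prop :=
  ∀ s, ProbabilityTheory.Indep (N.filt s) (N.filtInfty.comap (N.θ s)) N.P

end NoiseSpace

/-- A (filtered, càdlàg) random dynamical system on `X` over the noise space `N`. -/
structure RDS {T Ω : Type*} [AddMonoid T] [Preorder T] [TopologicalSpace T] [MeasurableSpace Ω]
    (N : NoiseSpace T Ω) (X : Type*) [TopologicalSpace X] [mX : MeasurableSpace X] where
  /-- `map t ω x` is `φ(t,ω)x` -/
  map : T → Ω → X → X
  continuous_map : ∀ t ω, Continuous (map t ω)
  /-- `(ω,x) ↦ φ(t,ω)x` is measurable with respect to the product of `F_t` and the given (Borel)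
  σ-algebra of `X` -/
  measurable_map : ∀ t, Measurable[(N.filt t).prod mX] (fun p : Ω × X => map t p.1 p.2)
  map_zero : ∀ ω x, map 0 ω x = x
  map_add : ∀ s t ω x, map (s + t) ω x = map t (N.θ s ω) (map s ω x)
  /-- right-continuity -/
  right_continuous : ∀ (ω : Ω) (u : ℕ → T) (t : T) (y : ℕ → X) (x : X),
    Antitone u → Tendsto u atTop (𝓝 t) → Tendsto y atTop (𝓝 x) →
      Tendsto (fun n => map (u n) ω (y n)) atTop (𝓝 (map t ω x))
  /-- existence of left limits -/
  left_limits : ∃ mapLeft : T → Ω → X → X,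
    ∀ (ω : Ω) (u : ℕ → T) (t : T) (y : ℕ → X) (x : X),
      StrictMono u → Tendsto u atTop (𝓝 t) → Tendsto y atTop (𝓝 x) →
        Tendsto (fun n => map (u n) ω (y n)) atTop (𝓝 (mapLeft t ω x))

/-- Given a probability `P` on `Ω` and a family `ψ` of self-maps of `Y`, an (open) set `U` is accessible
from `y` if with positive probability the trajectory of `y` visits `U`. -/
def IsAccessible {T Ω Y : Type*} [MeasurableSpace Ω] (P : Measure Ω) (ψ : T → Ω → Y → Y)
    (y : Y) (U : Set Y) : Prop :=
  0 < P {ω | ∃ t, ψ t ω y ∈ U}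

namespace RDS

section Topological

variable {T Ω X : Type*} [AddMonoid T] [Preorder T] [TopologicalSpace T] [MeasurableSpace Ω]
  [TopologicalSpace X] [MeasurableSpace X] {N : NoiseSpace T Ω}

/-- The two-point motion `φ × φ`. -/
def twoPointMotion (φ : RDS N X) : T → Ω → X × X → X × X :=
  fun t ω p => (φ.map t ω p.1, φ.map t ω p.2)

/-- A closed set is forward-invariant if, almost surely, every `φ(t,ω)` maps it into itself. -/
def IsForwardInvariant (φ : RDS N X) (K : Set X) : Prop :=
  ∀ᵐ ω ∂N.P, ∀ t, φ.map t ω '' K ⊆ K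

/-- Minimal sets: non-empty closed forward-invariant sets whose only closed forward-invariant subsets are
the set itself and the empty set. -/
def IsMinimalSet (φ : RDS N X) (K : Set X) : Prop :=
  K.Nonempty ∧ IsClosed K ∧ φ.IsForwardInvariant K ∧
    ∀ C ⊆ K, IsClosed C → φ.IsForwardInvariant C → C = K ∨ C = ∅

/-- The pair `(x,y)` is contractible if every (open) neighbourhood of the diagonal is accessible from
`(x,y)` under the two-point motion. -/
def IsContractiblePair (φ : RDS N X) (x y : X) : Prop :=
  ∀ V : Set (X × X), IsOpen V → diagonal X ⊆ V → IsAccessible N.P φ.twoPointMotion (x, y) V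

/-- Two-point contractibility on a (closed forward-invariant) set. -/
def IsTwoPointContractibleOn (φ : RDS N X) (K : Set X) : Prop :=
  ∀ x ∈ K, ∀ y ∈ K, φ.IsContractiblePair x y

end Topological

section Metric

variable {T Ω X : Type*} [AddMonoid T] [Preorder T] [TopologicalSpace T] [MeasurableSpace Ω]
  [MetricSpace X] [MeasurableSpace X] {N : NoiseSpace T Ω}

/-- `A` contracts under `ω`: `diam (φ(t,ω)A) → 0` as `t → ∞`. -/
def Contracts (φ : RDS N X) (ω : Ω) (A : Set X) : Prop :=
  Tendsto (fun t => Metric.diam (φ.map t ω '' A)) atTop (𝓝 0)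

/-- Any two points almost surely mutually converge. -/
def IsSynchronising (φ : RDS N X) : Prop :=
  ∀ x y, ∀ᵐ ω ∂N.P, φ.Contracts ω {x, y}

/-- `(ω,x)` is asymptotically stable if some neighbourhood of `x` contracts under `ω`. -/
def IsAsymptoticallyStable (φ : RDS N X) (ω : Ω) (x : X) : Prop :=
  ∃ U ∈ 𝓝 x, φ.Contracts ω U

/-- `x` is almost surely stable if `(ω,x)` is asymptotically stable for almost all `ω`. -/
def IsAlmostSurelyStable (φ : RDS N X) (x : X) : Prop :=
  ∀ᵐ ω ∂N.P, φ.IsAsymptoticallyStable ω x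

/-- Stably synchronising: synchronising, and every point is almost surely stable. -/
def IsStablySynchronising (φ : RDS N X) : Prop :=
  φ.IsSynchronising ∧ ∀ x, φ.IsAlmostSurelyStable x

/-- A (closed forward-invariant) set `K` admits stable trajectories if with positive probability there is
`x ∈ K` with `(ω,x)` asymptotically stable. -/
def AdmitsStableTrajectories (φ : RDS N X) (K : Set X) : Prop :=
  0 < N.P {ω | ∃ x ∈ K, φ.IsAsymptoticallyStable ω x}

end Metric

end RDS

/-!
That stable synchronisation implies the three conditions is elementary. Minimal sets exist by Zorn's
lemma and compactness; two distinct ones would be disjoint, hence at positive distance, and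
trajectories started in them could not converge to each other. Almost sure convergence of
trajectories gives contractibility, and almost sure stability gives stable trajectories.

Conversely, let `K` be the unique minimal set. The set of points accessible from a given initial
point is closed and forward-invariant (`isForwardInvariant_accessibleSet`, which rests on the Markov
property `NoiseSpace.IsMemoryless.measure_inter_preimage`). For the two-point motion started at
`(x, y)` this set contains a minimal set `M` of the two-point motion. Both projections of `M` contain
`K` by uniqueness, so `M ⊆ K × K` by minimality, and two-point contractibility forces `M` to meet the
diagonal. From a diagonal point over `K` the motion can visit `U × U` for every open `U` meeting `K`,
so `(x, y)` can as well (`isAccessible_twoPointMotion_of_unique`).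

As `K` admits stable trajectories, some open `U` meeting `K` contracts with positive probability.
Once both trajectories are in `U`, independence lets `U` contract afterwards, so with positive
probability a common neighbourhood of `x` and `y` contracts (`measure_jointStabilityEvent_pos`). The
same then holds with fixed neighbourhoods for all nearby pairs, and compactness of `X × X` bounds the
conditional probability of this event given `F_t` below by a constant independent of `t`, `x` and
`y`. An event of `F_∞` with this property is almost sure
(`NoiseSpace.measure_compl_eq_zero_of_le`), because the events of the `F_t` are dense in `F_∞`.

Both time sets are treated at once through `CountableRightDense`.
-/

/-! ### Time sets and measure-theoretic preliminaries -/

/-- The time set `T` has a countable subset from which every time can be approximated from the right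
by a decreasing sequence. This is what makes events about right-continuous trajectories, a priori
involving uncountably many times, depend on countably many times only. -/
class CountableRightDense (T : Type*) [Preorder T] [TopologicalSpace T] : Prop where
  exists_countable : ∃ Q : Set T, Q.Countable ∧
    ∀ t, ∃ u : ℕ → T, Antitone u ∧ (∀ n, u n ∈ Q ∧ t ≤ u n) ∧ Tendsto u atTop (𝓝 t)

instance : CountableRightDense ℕ where
  exists_countable := ⟨univ, countable_univ, fun t =>
    ⟨fun _ => t, antitone_const, fun _ => ⟨mem_univ _, le_rfl⟩, tendsto_const_nhds⟩⟩

instance : CountableRightDense ℝ≥0 where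
  exists_countable := by
    obtain ⟨Q, hQ, hd⟩ := TopologicalSpace.exists_countable_dense ℝ≥0
    refine ⟨Q, hQ, fun t => ?_⟩
    obtain ⟨u, hu, hmem, hlim⟩ := hd.exists_seq_strictAnti_tendsto t
    exact ⟨u, hu.antitone, fun n => ⟨(hmem n).2, (hmem n).1.le⟩, hlim⟩

theorem exists_measure_pos_of_subset_biUnion {Ω ι : Type*} [MeasurableSpace Ω] {μ : Measure Ω}
    {I : Set ι} (hI : I.Countable) {s : Set Ω} {f : ι → Set Ω} (hs : 0 < μ s)
    (h : s ⊆ ⋃ i ∈ I, f i) : ∃ i ∈ I, 0 < μ (f i) := by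
  by_contra! hf
  refine hs.ne' (measure_mono_null h ((measure_biUnion_null_iff hI).2 fun i hi => ?_))
  exact le_antisymm (hf i hi) zero_le

theorem measurable_twoPoint {Ω X : Type*} [MeasurableSpace Ω] [MeasurableSpace X] {f : Ω × X → X}
    (hf : Measurable f) :
    Measurable fun p : Ω × (X × X) => (f (p.1, p.2.1), f (p.1, p.2.2)) := by
  fun_prop

/-! ### Memoryless noise -/

namespace NoiseSpace

variable {T Ω : Type*} [AddCommMonoid T] [LinearOrder T] [MeasurableSpace Ω] {N : NoiseSpace T Ω}

theorem filt_le_filtInfty (N : NoiseSpace T Ω) (t : T) : N.filt t ≤ N.filtInfty :=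
  le_iSup (fun t => (N.filt t : MeasurableSpace Ω)) t

theorem filtInfty_le (N : NoiseSpace T Ω) : N.filtInfty ≤ ‹MeasurableSpace Ω› :=
  iSup_le N.filt.le

/-- The Markov property in set form: the past up to time `s` is independent of what the noise
does after time `s`, and the latter has the original law. -/
theorem IsMemoryless.measure_inter_preimage (hN : N.IsMemoryless) {s : T} {A G : Set Ω}
    (hA : MeasurableSet[N.filt s] A) (hG : MeasurableSet[N.filtInfty] G) :
    N.P (A ∩ N.θ s ⁻¹' G) = N.P A * N.P G := by
  rw [(ProbabilityTheory.Indep_iff _ _ _).1 (hN s) A _ hA ⟨G, hG, rfl⟩,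
    (N.θ_measurePreserving s).measure_preimage (N.filtInfty_le _ hG).nullMeasurableSet]

/-- The events known at some finite time are dense among the events of `F_∞`. -/
theorem exists_measure_symmDiff_lt (N : NoiseSpace T Ω) {E : Set Ω}
    (hE : MeasurableSet[N.filtInfty] E) {ε : ℝ} (hε : 0 < ε) :
    ∃ t A, MeasurableSet[N.filt t] A ∧ N.P (symmDiff E A) < ENNReal.ofReal ε := by
  have := N.isProbabilityMeasure
  let C : Set (Set Ω) := {A | ∃ t, MeasurableSet[N.filt t] A}
  have hC : IsSetAlgebra C :=
    { empty_mem := ⟨0, @MeasurableSet.empty _ (N.filt 0)⟩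
      compl_mem := fun A ⟨t, hA⟩ => ⟨t, hA.compl⟩
      union_mem := fun A B ⟨s, hA⟩ ⟨t, hB⟩ =>
        ⟨max s t, (N.filt.mono (le_max_left s t) _ hA).union (N.filt.mono (le_max_right s t) _ hB)⟩ }
  have hgen : N.filtInfty = MeasurableSpace.generateFrom C := by
    have : C = ⋃ t, {A | MeasurableSet[N.filt t] A} := by ext; simp [C]
    rw [this]
    exact (MeasurableSpace.generateFrom_iUnion_measurableSet _).symm
  have hfin : IsFiniteMeasure (N.P.trim N.filtInfty_le) := isFiniteMeasure_trim _
  obtain ⟨A, ⟨t, hA⟩, h⟩ := @Measure.MeasureDense.approx Ω N.filtInfty (N.P.trim N.filtInfty_le) C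
    (@Measure.MeasureDense.of_generateFrom_isSetAlgebra_finite Ω
      N.filtInfty (N.P.trim N.filtInfty_le) C hfin hC hgen) E hE
    (@measure_ne_top _ N.filtInfty _ hfin _) ε hε
  exact ⟨t, A, hA, (le_trim _).trans_lt h⟩

/-- A zero-one law: an event of `F_∞` whose conditional probability given the present is bounded
below by a positive constant at all times is almost sure. -/
theorem measure_compl_eq_zero_of_le (N : NoiseSpace T Ω) {E : Set Ω}
    (hE : MeasurableSet[N.filtInfty] E) {c : ENNReal} (hc : 0 < c)
    (h : ∀ t A, MeasurableSet[N.filt t] A → c * N.P A ≤ N.P (A ∩ E)) : N.P Eᶜ = 0 := by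
  have := N.isProbabilityMeasure
  have hc1 : c ≤ 1 := by
    simpa using (h 0 univ (@MeasurableSet.univ _ (N.filt 0))).trans prob_le_one
  have key : ∀ ε : ℝ, 0 < ε → c * N.P Eᶜ ≤ ENNReal.ofReal ε + ENNReal.ofReal ε := by
    intro ε hε
    obtain ⟨t, A, hA, hlt⟩ := N.exists_measure_symmDiff_lt
      (@MeasurableSet.compl _ _ N.filtInfty hE) hε
    have h1 : N.P Eᶜ ≤ N.P A + ENNReal.ofReal ε := by
      refine (measure_mono (t := A ∪ symmDiff Eᶜ A) fun ω hω => ?_).trans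
        ((measure_union_le _ _).trans (by gcongr))
      by_cases hωA : ω ∈ A
      · exact Or.inl hωA
      · exact Or.inr (Or.inl ⟨hω, hωA⟩)
    have h2 : N.P (A ∩ E) ≤ ENNReal.ofReal ε :=
      (measure_mono fun ω hω => Or.inr ⟨hω.1, fun h => h hω.2⟩).trans hlt.le
    calc c * N.P Eᶜ ≤ c * (N.P A + ENNReal.ofReal ε) := by gcongr
      _ = c * N.P A + c * ENNReal.ofReal ε := mul_add _ _ _
      _ ≤ ENNReal.ofReal ε + 1 * ENNReal.ofReal ε := by
        gcongr
        exact (h t A hA).trans h2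
      _ = _ := by rw [one_mul]
  have hzero : c * N.P Eᶜ = 0 := by
    by_contra hne
    have hfin : c * N.P Eᶜ ≠ ⊤ :=
      ENNReal.mul_ne_top (ne_top_of_le_ne_top ENNReal.one_ne_top hc1) (measure_ne_top _ _)
    have hpos := ENNReal.toReal_pos hne hfin
    have := key ((c * N.P Eᶜ).toReal / 3) (by positivity)
    rw [← ENNReal.ofReal_add (by positivity) (by positivity),
      ENNReal.le_ofReal_iff_toReal_le hfin (by positivity)] at this
    linarith
  exact (mul_eq_zero.1 hzero).resolve_left hc.ne'

end NoiseSpace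

/-! ### Accessibility -/

namespace RDS

section Accessibility

variable {T Ω X : Type*} [AddCommMonoid T] [LinearOrder T] [TopologicalSpace T]
  [MeasurableSpace Ω] [MetricSpace X] [MeasurableSpace X] {N : NoiseSpace T Ω}

theorem measurable_map_apply (φ : RDS N X) (t : T) (x : X) :
    Measurable[N.filt t] (fun ω => φ.map t ω x) :=
  (φ.measurable_map t).comp (@measurable_prodMk_right Ω X (N.filt t) _ x)

/-- For closed `F` it suffices to test the inclusion `φ(t,ω)V ⊆ F` on a countable dense subset
of `V`. -/
theorem measurableSet_mapsTo [CompactSpace X] [BorelSpace X] (φ : RDS N X) (t : T) (V : Set X)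
    {F : Set X} (hF : IsClosed F) : MeasurableSet[N.filt t] {ω | MapsTo (φ.map t ω) V F} := by
  obtain ⟨D, hDV, hD, hdense⟩ :=
    (TopologicalSpace.IsSeparable.of_separableSpace V).exists_countable_dense_subset
  have : {ω | MapsTo (φ.map t ω) V F} = ⋂ x ∈ D, {ω | φ.map t ω x ∈ F} := by
    ext ω
    simp only [mem_ofPred_eq, mem_iInter]
    refine ⟨fun h x hx => h (hDV hx), fun h x hx => ?_⟩
    exact closure_minimal (s := D) h (hF.preimage (φ.continuous_map t ω)) (hdense hx)
  rw [this]
  exact MeasurableSet.biInter hD fun x _ => φ.measurable_map_apply t x hF.measurableSet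

/-- The two-point motion of a random dynamical system is a random dynamical system on the square of
the phase space. -/
def prod (φ : RDS N X) : RDS N (X × X) where
  map := φ.twoPointMotion
  continuous_map t ω := (φ.continuous_map t ω).prodMap (φ.continuous_map t ω)
  measurable_map t := 
    @measurable_twoPoint _ _ (N.filt t) _ _ (φ.measurable_map t)
  map_zero ω p := Prod.ext (φ.map_zero ω p.1) (φ.map_zero ω p.2)
  map_add s t ω p := Prod.ext (φ.map_add s t ω p.1) (φ.map_add s t ω p.2)
  right_continuous ω u t y p hu ht hy :=
    (φ.right_continuous ω u t _ _ hu ht ((continuous_fst.tendsto p).comp hy)).prodMk_nhds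
      (φ.right_continuous ω u t _ _ hu ht ((continuous_snd.tendsto p).comp hy))
  left_limits := by
    obtain ⟨l, hl⟩ := φ.left_limits
    exact ⟨fun t ω p => (l t ω p.1, l t ω p.2), fun ω u t y p hu ht hy =>
      (hl ω u t _ _ hu ht ((continuous_fst.tendsto p).comp hy)).prodMk_nhds
        (hl ω u t _ _ hu ht ((continuous_snd.tendsto p).comp hy))⟩

/-- The set of points all of whose open neighbourhoods are accessible from `x`. -/
def accessibleSet (φ : RDS N X) (x : X) : Set X :=
  {z | ∀ U, IsOpen U → z ∈ U → IsAccessible N.P φ.map x U}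

theorem isClosed_accessibleSet (φ : RDS N X) (x : X) : IsClosed (φ.accessibleSet x) := by
  rw [← isOpen_compl_iff, isOpen_iff_forall_mem_open]
  intro z hz
  simp only [accessibleSet, mem_compl_iff, mem_ofPred_eq, not_forall] at hz
  obtain ⟨U, hU, hzU, hacc⟩ := hz
  exact ⟨U, fun w hw hw' => hacc (hw' U hU hw), hU, hzU⟩

/-- A closed forward-invariant set contains everything accessible from its points. -/
theorem accessibleSet_subset {φ : RDS N X} {C : Set X} (hC : IsClosed C)
    (hinv : φ.IsForwardInvariant C) {x : X} (hx : x ∈ C) : φ.accessibleSet x ⊆ C := by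
  intro z hz
  by_contra hzC
  refine (hz Cᶜ hC.isOpen_compl hzC).ne' (measure_mono_null ?_ (ae_iff.1 hinv))
  rintro ω ⟨t, ht⟩ h
  exact ht (h t (mem_image_of_mem _ hx))

theorem ae_mem_accessibleSet [CompactSpace X] (φ : RDS N X) (x : X) :
    ∀ᵐ ω ∂N.P, ∀ t, φ.map t ω x ∈ φ.accessibleSet x := by
  obtain ⟨S, hSc, hS, hSU⟩ := TopologicalSpace.isOpen_sUnion_countable
    {U : Set X | IsOpen U ∧ ¬ IsAccessible N.P φ.map x U} fun U hU => hU.1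
  have hae : ∀ᵐ ω ∂N.P, ∀ U ∈ S, ¬ ∃ t, φ.map t ω x ∈ U := by
    rw [ae_ball_iff hSc]
    intro U hU
    have := (hS hU).2
    simpa only [ae_iff, not_not] using nonpos_iff_eq_zero.1 (not_lt.1 this)
  filter_upwards [hae] with ω hω t U hU hmem
  by_contra hacc
  have : φ.map t ω x ∈ ⋃₀ S := hSU ▸ mem_sUnion_of_mem hmem ⟨hU, hacc⟩
  obtain ⟨V, hV, hmemV⟩ := this
  exact hω V hV ⟨t, hmemV⟩

theorem accessibleSet_nonempty [CompactSpace X] (φ : RDS N X) (x : X) :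
    (φ.accessibleSet x).Nonempty := by
  have := N.isProbabilityMeasure
  obtain ⟨ω, hω⟩ := (φ.ae_mem_accessibleSet x).exists
  exact ⟨_, hω 0⟩

variable [CountableRightDense T]

theorem exists_measure_pos_of_isAccessible (φ : RDS N X) {x : X} {U : Set X} (hU : IsOpen U)
    (h : IsAccessible N.P φ.map x U) : ∃ t, 0 < N.P {ω | φ.map t ω x ∈ U} := by
  obtain ⟨Q, hQ, happ⟩ := CountableRightDense.exists_countable (T := T)
  obtain ⟨t, -, ht⟩ := exists_measure_pos_of_subset_biUnion hQ
    (f := fun t => {ω | φ.map t ω x ∈ U}) h (by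
      rintro ω ⟨t, ht⟩
      obtain ⟨u, hu, hmem, hlim⟩ := happ t
      obtain ⟨n, hn⟩ := ((φ.right_continuous ω u t _ x hu hlim tendsto_const_nhds).eventually
        (hU.mem_nhds ht)).exists
      exact mem_biUnion (hmem n).1 hn)
  exact ⟨t, ht⟩

variable [CompactSpace X] [BorelSpace X]

/-- Accessibility is transitive: if `U` is reached from `z` at time `t` with positive probability,
then with positive probability `φ(t,·)` maps a whole neighbourhood of `z` into `U`, and this
neighbourhood is accessible from `x`. -/
theorem IsAccessible.of_mem_accessibleSet (hN : N.IsMemoryless) {φ : RDS N X} {x z : X}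
    (hz : z ∈ φ.accessibleSet x) {U : Set X} (hU : IsOpen U)
    (h : IsAccessible N.P φ.map z U) : IsAccessible N.P φ.map x U := by
  obtain ⟨t, ht⟩ := φ.exists_measure_pos_of_isAccessible hU h
  have hB := TopologicalSpace.isBasis_countableBasis X
  have hBc := TopologicalSpace.countable_countableBasis X
  obtain ⟨⟨V, W⟩, ⟨⟨hV, hzV⟩, -, hWU⟩, hpos⟩ := exists_measure_pos_of_subset_biUnion
    (I := {V ∈ TopologicalSpace.countableBasis X | z ∈ V} ×ˢ
      {W ∈ TopologicalSpace.countableBasis X | closure W ⊆ U})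
    (f := fun p => {ω | MapsTo (φ.map t ω) p.1 (closure p.2)})
    ((hBc.mono (sep_subset _ _)).prod (hBc.mono (sep_subset _ _))) ht (by
      intro ω hω
      obtain ⟨W, hW, hzW, hWU⟩ := hB.exists_closure_subset (hU.mem_nhds hω)
      obtain ⟨V, hV, hzV, hVW⟩ := hB.mem_nhds_iff.1
        ((φ.continuous_map t ω).continuousAt.preimage_mem_nhds ((hB.isOpen hW).mem_nhds hzW))
      exact mem_biUnion (x := (V, W)) ⟨⟨hV, hzV⟩, hW, hWU⟩
        fun v hv => subset_closure (hVW hv))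
  obtain ⟨s, hs⟩ := φ.exists_measure_pos_of_isAccessible (hB.isOpen hV) (hz V (hB.isOpen hV) hzV)
  have hmeas := hN.measure_inter_preimage
    (φ.measurable_map_apply s x (hB.isOpen hV).measurableSet)
    (N.filt_le_filtInfty t _ (φ.measurableSet_mapsTo t V (isClosed_closure (s := W))))
  refine (ENNReal.mul_pos hs.ne' hpos.ne').trans_le (hmeas.symm.le.trans (measure_mono ?_))
  rintro ω ⟨h1, h2⟩
  refine ⟨s + t, ?_⟩
  rw [φ.map_add]
  exact hWU (h2 h1)

theorem isForwardInvariant_accessibleSet (hN : N.IsMemoryless) (φ : RDS N X) (x : X) :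
    φ.IsForwardInvariant (φ.accessibleSet x) := by
  obtain ⟨Q, hQ, happ⟩ := CountableRightDense.exists_countable (T := T)
  obtain ⟨D, hDA, hD, hdense⟩ := (TopologicalSpace.IsSeparable.of_separableSpace
    (φ.accessibleSet x)).exists_countable_dense_subset
  have hcl := φ.isClosed_accessibleSet x
  -- The complement of the accessible set is inaccessible from `x`, hence from each of its points.
  have hD_inv : ∀ᵐ ω ∂N.P, ∀ z ∈ D, ∀ t, φ.map t ω z ∈ φ.accessibleSet x := by
    rw [ae_ball_iff hD]
    intro z hz
    by_contra hne
    have hacc : IsAccessible N.P φ.map z (φ.accessibleSet x)ᶜ := by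
      refine pos_iff_ne_zero.2 fun h0 => hne ?_
      simpa [ae_iff] using h0
    have h1 := (IsAccessible.of_mem_accessibleSet hN (hDA hz) hcl.isOpen_compl hacc).ne'
    refine h1 ?_
    simpa [ae_iff] using φ.ae_mem_accessibleSet x
  filter_upwards [hD_inv] with ω hω t
  rintro _ ⟨z, hz, rfl⟩
  exact closure_minimal (s := D) (fun w hw => hω w hw t)
    (hcl.preimage (φ.continuous_map t ω)) (hdense hz)

end Accessibility
/-! ### Minimal sets -/

section Minimal

variable {T Ω X : Type*} [AddCommMonoid T] [LinearOrder T] [TopologicalSpace T]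
  [MeasurableSpace Ω] [MetricSpace X] [MeasurableSpace X] {N : NoiseSpace T Ω}

theorem IsForwardInvariant.inter {φ : RDS N X} {C D : Set X} (hC : φ.IsForwardInvariant C)
    (hD : φ.IsForwardInvariant D) : φ.IsForwardInvariant (C ∩ D) := by
  filter_upwards [hC, hD] with ω h1 h2 t
  rintro _ ⟨x, hx, rfl⟩
  exact ⟨h1 t ⟨x, hx.1, rfl⟩, h2 t ⟨x, hx.2, rfl⟩⟩

/-- Arbitrary intersections are allowed although forward-invariance holds only almost surely,
because by second countability the intersection is that of a countable subfamily. -/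
theorem isForwardInvariant_sInter [SecondCountableTopology X] {φ : RDS N X} {S : Set (Set X)}
    (hcl : ∀ C ∈ S, IsClosed C) (hinv : ∀ C ∈ S, φ.IsForwardInvariant C) :
    φ.IsForwardInvariant (⋂₀ S) := by
  obtain ⟨R, hRS, hRc, hR⟩ := TopologicalSpace.isOpen_biUnion_countable S (fun C => Cᶜ)
    fun C hC => (hcl C hC).isOpen_compl
  have hR' : ⋂₀ S = ⋂ C ∈ R, C := by
    rw [sInter_eq_biInter, ← compl_inj_iff]
    simpa only [compl_iInter] using hR.symm
  have hae : ∀ᵐ ω ∂N.P, ∀ C ∈ R, ∀ t, φ.map t ω '' C ⊆ C :=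
    (ae_ball_iff hRc).2 fun C hC => hinv C (hRS hC)
  rw [hR']
  filter_upwards [hae] with ω hω t
  rintro _ ⟨x, hx, rfl⟩
  simp only [mem_iInter] at hx ⊢
  exact fun C hC => hω C hC t ⟨x, hx C hC, rfl⟩

theorem isForwardInvariant_univ (φ : RDS N X) : φ.IsForwardInvariant univ :=
  Eventually.of_forall fun _ _ => subset_univ _

theorem exists_isMinimalSet_subset [CompactSpace X] {φ : RDS N X} {C : Set X} (hne : C.Nonempty)
    (hcl : IsClosed C) (hinv : φ.IsForwardInvariant C) : ∃ M ⊆ C, φ.IsMinimalSet M := by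
  obtain ⟨M, hMC, hM⟩ := zorn_superset_nonempty
    {C : Set X | C.Nonempty ∧ IsClosed C ∧ φ.IsForwardInvariant C} (by
      intro S hS hchain hSne
      have := hSne.to_subtype
      refine ⟨⋂₀ S, ⟨?_, isClosed_sInter fun C hC => (hS hC).2.1,
        isForwardInvariant_sInter (fun C hC => (hS hC).2.1) fun C hC => (hS hC).2.2⟩,
        fun C hC => sInter_subset_of_mem hC⟩
      exact IsCompact.nonempty_sInter_of_directed_nonempty_isCompact_isClosed
        (fun C hC D hD => (hchain.total hC hD).elim (fun h => ⟨C, hC, subset_rfl, h⟩)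
          fun h => ⟨D, hD, h, subset_rfl⟩) (fun C hC => (hS hC).1) (fun C hC => (hS hC).2.1.isCompact)
        fun C hC => (hS hC).2.1) C ⟨hne, hcl, hinv⟩
  refine ⟨M, hMC, hM.prop.1, hM.prop.2.1, hM.prop.2.2, fun D hDM hDcl hDinv => ?_⟩
  rcases D.eq_empty_or_nonempty with hD | hD
  · exact Or.inr hD
  · exact Or.inl (hDM.antisymm (hM.le_of_le ⟨hD, hDcl, hDinv⟩ hDM))

theorem IsForwardInvariant.fst_image {φ : RDS N X} {M : Set (X × X)}
    (hM : φ.prod.IsForwardInvariant M) : φ.IsForwardInvariant (Prod.fst '' M) := by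
  filter_upwards [hM] with ω h t
  rintro _ ⟨_, ⟨p, hp, rfl⟩, rfl⟩
  exact ⟨_, h t ⟨p, hp, rfl⟩, rfl⟩

theorem IsForwardInvariant.snd_image {φ : RDS N X} {M : Set (X × X)}
    (hM : φ.prod.IsForwardInvariant M) : φ.IsForwardInvariant (Prod.snd '' M) := by
  filter_upwards [hM] with ω h t
  rintro _ ⟨_, ⟨p, hp, rfl⟩, rfl⟩
  exact ⟨_, h t ⟨p, hp, rfl⟩, rfl⟩

theorem IsForwardInvariant.fst_preimage {φ : RDS N X} {K : Set X}
    (hK : φ.IsForwardInvariant K) : φ.prod.IsForwardInvariant (Prod.fst ⁻¹' K) := by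
  filter_upwards [hK] with ω h t
  rintro _ ⟨p, hp, rfl⟩
  exact h t ⟨p.1, hp, rfl⟩

theorem IsForwardInvariant.snd_preimage {φ : RDS N X} {K : Set X}
    (hK : φ.IsForwardInvariant K) : φ.prod.IsForwardInvariant (Prod.snd ⁻¹' K) := by
  filter_upwards [hK] with ω h t
  rintro _ ⟨p, hp, rfl⟩
  exact h t ⟨p.2, hp, rfl⟩

theorem IsMinimalSet.subset_of_inter_nonempty {φ : RDS N X} {M C : Set X} (hM : φ.IsMinimalSet M)
    (hC : IsClosed C) (hinv : φ.IsForwardInvariant C) (h : (M ∩ C).Nonempty) : M ⊆ C := by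
  rcases hM.2.2.2 _ inter_subset_left (hM.2.1.inter hC) (hM.2.2.1.inter hinv) with h' | h'
  · exact inter_eq_left.1 h'
  · exact absurd h' h.ne_empty

variable [CompactSpace X] [BorelSpace X] [CountableRightDense T]

theorem IsMinimalSet.subset_accessibleSet (hN : N.IsMemoryless) {φ : RDS N X} {K : Set X}
    (hK : φ.IsMinimalSet K) {x : X} (hx : x ∈ K) : K ⊆ φ.accessibleSet x := by
  obtain ⟨z, hz⟩ := φ.accessibleSet_nonempty x
  exact hK.subset_of_inter_nonempty (φ.isClosed_accessibleSet x)
    (φ.isForwardInvariant_accessibleSet hN x)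
    ⟨z, accessibleSet_subset hK.2.1 hK.2.2.1 hx hz, hz⟩

/-- If `K` is the only minimal set and any two points of `K` can approach each other, then every
minimal set of the two-point motion lies in `K × K` and meets the diagonal. Hence, whatever the
initial points, both trajectories can be simultaneously in any given open set meeting `K`. -/
theorem isAccessible_twoPointMotion_of_unique (hN : N.IsMemoryless) {φ : RDS N X} {K : Set X}
    (hK : φ.IsMinimalSet K) (huniq : ∀ K', φ.IsMinimalSet K' → K' = K)
    (hcontr : φ.IsTwoPointContractibleOn K) {U : Set X} (hU : IsOpen U) (hUK : (U ∩ K).Nonempty)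
    (x y : X) : IsAccessible N.P φ.twoPointMotion (x, y) (U ×ˢ U) := by
  obtain ⟨M, hMacc, hM⟩ := exists_isMinimalSet_subset (φ.prod.accessibleSet_nonempty (x, y))
    (φ.prod.isClosed_accessibleSet _) (φ.prod.isForwardInvariant_accessibleSet hN _)
  have hMc := hM.2.1.isCompact
  have hsub : ∀ C : Set X, C.Nonempty → IsClosed C → φ.IsForwardInvariant C → K ⊆ C := by
    intro C hne hcl hinv
    obtain ⟨K', hK'C, hK'⟩ := exists_isMinimalSet_subset hne hcl hinv
    exact huniq K' hK' ▸ hK'C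
  obtain ⟨k, hk⟩ := hK.1
  have hfst : M ⊆ Prod.fst ⁻¹' K := by
    obtain ⟨p, hp, hpk⟩ := hsub _ (hM.1.image _) (hMc.image continuous_fst).isClosed
      hM.2.2.1.fst_image hk
    exact hM.subset_of_inter_nonempty (hK.2.1.preimage continuous_fst) hK.2.2.1.fst_preimage
      ⟨p, hp, by rwa [mem_preimage, hpk]⟩
  have hsnd : M ⊆ Prod.snd ⁻¹' K := by
    obtain ⟨p, hp, hpk⟩ := hsub _ (hM.1.image _) (hMc.image continuous_snd).isClosed
      hM.2.2.1.snd_image hk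
    exact hM.subset_of_inter_nonempty (hK.2.1.preimage continuous_snd) hK.2.2.1.snd_preimage
      ⟨p, hp, by rwa [mem_preimage, hpk]⟩
  obtain ⟨z, hz⟩ : ∃ z, (z, z) ∈ M := by
    by_contra! hdiag
    obtain ⟨p, hp⟩ := hM.1
    -- Otherwise `Mᶜ` is a neighbourhood of the diagonal, which trajectories from `M` never visit.
    refine (hcontr p.1 (hfst hp) p.2 (hsnd hp) Mᶜ hM.2.1.isOpen_compl ?_).ne'
      (measure_mono_null ?_ (ae_iff.1 hM.2.2.1))
    · rintro ⟨a, b⟩ hab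
      obtain rfl : a = b := hab
      exact hdiag a
    · rintro ω ⟨t, ht⟩ h
      exact ht (h t (mem_image_of_mem _ hp))
  obtain ⟨u, huU, huK⟩ := hUK
  have hzz : IsAccessible N.P φ.prod.map (z, z) (U ×ˢ U) := by
    have h := hK.subset_accessibleSet hN (hfst hz) huK U hU huU
    simpa only [IsAccessible, prod, twoPointMotion, mem_prod, and_self] using h
  exact IsAccessible.of_mem_accessibleSet hN (hMacc hz) (hU.prod hU) hzz

end Minimal

/-! ### Contraction and joint stability -/

section Contraction

variable {T Ω X : Type*} [AddCommMonoid T] [LinearOrder T] [TopologicalSpace T]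
  [MeasurableSpace Ω] [MetricSpace X] [CompactSpace X] [MeasurableSpace X] {N : NoiseSpace T Ω}

theorem contracts_iff {φ : RDS N X} {ω : Ω} {A : Set X} : φ.Contracts ω A ↔
    ∀ ε > 0, ∃ s, ∀ t ≥ s, ∀ x ∈ A, ∀ y ∈ A, dist (φ.map t ω x) (φ.map t ω y) ≤ ε := by
  rw [Contracts, Metric.tendsto_atTop]
  constructor
  · intro h ε hε
    obtain ⟨s, hs⟩ := h ε hε
    refine ⟨s, fun t ht x hx y hy => (Metric.dist_le_diam_of_mem (isCompact_univ.isBounded.subset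
      (subset_univ _)) (mem_image_of_mem _ hx) (mem_image_of_mem _ hy)).trans ?_⟩
    have := hs t ht
    rw [Real.dist_0_eq_abs] at this
    exact (le_abs_self _).trans this.le
  · intro h ε hε
    obtain ⟨s, hs⟩ := h (ε / 2) (half_pos hε)
    refine ⟨s, fun t ht => ?_⟩
    rw [Real.dist_0_eq_abs, abs_of_nonneg Metric.diam_nonneg]
    refine (Metric.diam_le_of_forall_dist_le (half_pos hε).le ?_).trans_lt (half_lt_self hε)
    rintro _ ⟨x, hx, rfl⟩ _ ⟨y, hy, rfl⟩
    exact hs t ht x hx y hy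

theorem Contracts.mono {φ : RDS N X} {ω : Ω} {A B : Set X} (hB : φ.Contracts ω B) (h : A ⊆ B) :
    φ.Contracts ω A := by
  rw [contracts_iff] at hB ⊢
  intro ε hε
  obtain ⟨s, hs⟩ := hB ε hε
  exact ⟨s, fun t ht x hx y hy => hs t ht x (h hx) y (h hy)⟩

theorem Contracts.of_mapsTo [IsOrderedCancelAddMonoid T] [CanonicallyOrderedAdd T] {φ : RDS N X}
    {ω : Ω} {s : T} {A B : Set X} (hB : φ.Contracts (N.θ s ω) B) (h : MapsTo (φ.map s ω) A B) :
    φ.Contracts ω A := by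
  rw [contracts_iff] at hB ⊢
  intro ε hε
  obtain ⟨r, hr⟩ := hB ε hε
  refine ⟨s + r, fun t ht x hx y hy => ?_⟩
  obtain ⟨q, rfl⟩ := exists_add_of_le (le_self_add.trans ht)
  rw [φ.map_add, φ.map_add]
  exact hr q (le_of_add_le_add_left ht) _ (h hx) _ (h hy)

/-- By right-continuity in time and continuity in space, contraction can be tested at countably many
times and points. -/
theorem measurableSet_contracts [BorelSpace X] [CountableRightDense T] (φ : RDS N X) (A : Set X) :
    MeasurableSet[N.filtInfty] {ω | φ.Contracts ω A} := by
  obtain ⟨Q, hQ, happ⟩ := CountableRightDense.exists_countable (T := T)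
  obtain ⟨D, hDA, hD, hdense⟩ :=
    (TopologicalSpace.IsSeparable.of_separableSpace A).exists_countable_dense_subset
  have hset : {ω | φ.Contracts ω A} = ⋂ n : ℕ, ⋃ s ∈ Q, ⋂ t ∈ {t ∈ Q | s ≤ t}, ⋂ x ∈ D, ⋂ y ∈ D,
      {ω | dist (φ.map t ω x) (φ.map t ω y) ≤ 1 / ((n : ℝ) + 1)} := by
    ext ω
    simp only [mem_ofPred_eq, mem_iInter, mem_iUnion, contracts_iff]
    constructor
    · intro h n
      obtain ⟨s, hs⟩ := h (1 / ((n : ℝ) + 1)) Nat.one_div_pos_of_nat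
      obtain ⟨u, -, hu, -⟩ := happ s
      exact ⟨u 0, (hu 0).1, fun t ht x hx y hy =>
        hs t ((hu 0).2.trans ht.2) x (hDA hx) y (hDA hy)⟩
    · intro h ε hε
      obtain ⟨n, hn⟩ := exists_nat_one_div_lt hε
      obtain ⟨s, -, hs⟩ := h n
      refine ⟨s, fun t ht x hx y hy => le_trans ?_ hn.le⟩
      have hpt : ∀ t ∈ Q, s ≤ t → ∀ x ∈ A, ∀ y ∈ A,
          dist (φ.map t ω x) (φ.map t ω y) ≤ 1 / ((n : ℝ) + 1) := by
        intro t htQ hst x hx y hy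
        have hclosed : IsClosed {p : X × X |
            dist (φ.map t ω p.1) (φ.map t ω p.2) ≤ 1 / ((n : ℝ) + 1)} :=
          isClosed_le (((φ.continuous_map t ω).comp continuous_fst).dist
            ((φ.continuous_map t ω).comp continuous_snd)) continuous_const
        refine closure_minimal (s := D ×ˢ D) (fun p hp => hs t ⟨htQ, hst⟩ _ hp.1 _ hp.2) hclosed
          (?_ : (x, y) ∈ _)
        rw [closure_prod_eq]
        exact ⟨hdense hx, hdense hy⟩
      obtain ⟨u, hu, hmem, hlim⟩ := happ t
      exact le_of_tendsto' ((φ.right_continuous ω u t _ x hu hlim tendsto_const_nhds).dist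
          (φ.right_continuous ω u t _ y hu hlim tendsto_const_nhds))
        fun m => hpt _ (hmem m).1 (ht.trans (hmem m).2) x hx y hy
  rw [hset]
  refine MeasurableSet.iInter fun n => MeasurableSet.biUnion hQ fun s _ =>
    MeasurableSet.biInter (hQ.mono (sep_subset _ _)) fun t _ => MeasurableSet.biInter hD fun x _ =>
    MeasurableSet.biInter hD fun y _ => N.filt_le_filtInfty t _ ?_
  exact φ.prod.measurable_map_apply t (x, y)
    (isClosed_le continuous_dist continuous_const).measurableSet

/-- The event that some common neighbourhood of `x` and `y` contracts. On this event the
trajectories of `x` and `y` converge to each other, and both points are asymptotically stable. -/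
def jointStabilityEvent (φ : RDS N X) (x y : X) : Set Ω :=
  {ω | ∃ U ∈ 𝓝 x ⊔ 𝓝 y, φ.Contracts ω U}

theorem mem_jointStabilityEvent_of_shift [IsOrderedCancelAddMonoid T] [CanonicallyOrderedAdd T]
    {φ : RDS N X} {ω : Ω} {s : T} {x y : X} {U : Set X} (hU : IsOpen U)
    (h : φ.Contracts (N.θ s ω) U) (hx : φ.map s ω x ∈ U) (hy : φ.map s ω y ∈ U) :
    ω ∈ φ.jointStabilityEvent x y :=
  ⟨φ.map s ω ⁻¹' U,
    ⟨(φ.continuous_map s ω).continuousAt.preimage_mem_nhds (hU.mem_nhds hx),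
      (φ.continuous_map s ω).continuousAt.preimage_mem_nhds (hU.mem_nhds hy)⟩,
    h.of_mapsTo fun _ hz => hz⟩

theorem jointStabilityEvent_eq_biUnion (φ : RDS N X) (x y : X) : φ.jointStabilityEvent x y =
    ⋃ p ∈ {U ∈ TopologicalSpace.countableBasis X | x ∈ U} ×ˢ
      {V ∈ TopologicalSpace.countableBasis X | y ∈ V}, {ω | φ.Contracts ω (p.1 ∪ p.2)} := by
  have hB := TopologicalSpace.isBasis_countableBasis X
  ext ω
  simp only [jointStabilityEvent, mem_ofPred_eq, mem_iUnion, exists_prop]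
  constructor
  · rintro ⟨W, ⟨hx, hy⟩, hW⟩
    obtain ⟨U, hU, hxU, hUW⟩ := hB.mem_nhds_iff.1 hx
    obtain ⟨V, hV, hyV, hVW⟩ := hB.mem_nhds_iff.1 hy
    exact ⟨(U, V), ⟨⟨hU, hxU⟩, hV, hyV⟩, hW.mono (union_subset hUW hVW)⟩
  · rintro ⟨⟨U, V⟩, ⟨⟨hU, hxU⟩, hV, hyV⟩, h⟩
    exact ⟨U ∪ V, ⟨mem_of_superset ((hB.isOpen hU).mem_nhds hxU) subset_union_left,
      mem_of_superset ((hB.isOpen hV).mem_nhds hyV) subset_union_right⟩, h⟩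

theorem exists_measure_contracts_pos {φ : RDS N X} {K : Set X}
    (h : φ.AdmitsStableTrajectories K) :
    ∃ U, IsOpen U ∧ (U ∩ K).Nonempty ∧ 0 < N.P {ω | φ.Contracts ω U} := by
  have hB := TopologicalSpace.isBasis_countableBasis X
  obtain ⟨U, ⟨hU, hUK⟩, hpos⟩ := exists_measure_pos_of_subset_biUnion
    (I := {U ∈ TopologicalSpace.countableBasis X | (U ∩ K).Nonempty})
    (f := fun U => {ω | φ.Contracts ω U})
    ((TopologicalSpace.countable_countableBasis X).mono (sep_subset _ _)) h (by
      rintro ω ⟨x, hxK, W, hW, hcontr⟩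
      obtain ⟨U, hU, hxU, hUW⟩ := hB.mem_nhds_iff.1 hW
      exact mem_biUnion (x := U) ⟨hU, x, hxU, hxK⟩ (hcontr.mono hUW))
  exact ⟨U, hB.isOpen hU, hUK, hpos⟩

variable [BorelSpace X] [CountableRightDense T]

theorem measurableSet_jointStabilityEvent (φ : RDS N X) (x y : X) :
    MeasurableSet[N.filtInfty] (φ.jointStabilityEvent x y) := by
  have hBc := TopologicalSpace.countable_countableBasis X
  rw [jointStabilityEvent_eq_biUnion]
  exact MeasurableSet.biUnion ((hBc.mono (sep_subset _ _)).prod (hBc.mono (sep_subset _ _)))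
    fun p _ => φ.measurableSet_contracts _

variable [IsOrderedCancelAddMonoid T] [CanonicallyOrderedAdd T]

/-- If both trajectories can enter a set that contracts with positive probability, then by
independence they can do so and subsequently be contracted. -/
theorem measure_jointStabilityEvent_pos (hN : N.IsMemoryless) {φ : RDS N X} {U : Set X}
    (hU : IsOpen U) (hcontr : 0 < N.P {ω | φ.Contracts ω U}) {x y : X}
    (hacc : IsAccessible N.P φ.twoPointMotion (x, y) (U ×ˢ U)) :
    0 < N.P (φ.jointStabilityEvent x y) := by
  obtain ⟨s, hs⟩ := φ.prod.exists_measure_pos_of_isAccessible (hU.prod hU) hacc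
  have hmeas := hN.measure_inter_preimage
    (φ.prod.measurable_map_apply s (x, y) (hU.prod hU).measurableSet)
    (φ.measurableSet_contracts U)
  refine (ENNReal.mul_pos hs.ne' hcontr.ne').trans_le (hmeas.symm.le.trans (measure_mono ?_))
  rintro ω ⟨h1, h2⟩
  exact mem_jointStabilityEvent_of_shift hU h2 h1.1 h1.2

/-- Compactness makes the conditional probability of joint stability, given the present, bounded
below uniformly in the initial points and in the present time. -/
theorem exists_forall_mul_le_measure_inter_jointStabilityEvent (hN : N.IsMemoryless) {φ : RDS N X}
    (hpos : ∀ x y, 0 < N.P (φ.jointStabilityEvent x y)) :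
    ∃ c > 0, ∀ x y t A, MeasurableSet[N.filt t] A →
      c * N.P A ≤ N.P (A ∩ φ.jointStabilityEvent x y) := by
  -- Induction over sets `S` of present positions. The measurable superset of `S` in the induction
  -- hypothesis allows an event to be split according to the present position when `S` is a union.
  obtain ⟨S, hS, -, c, hc, h⟩ := (isCompact_univ (X := X × X)).induction_on
    (p := fun S => ∃ S' ⊇ S, MeasurableSet S' ∧ ∃ c > 0, ∀ x y t A, MeasurableSet[N.filt t] A →
      (∀ ω ∈ A, φ.twoPointMotion t ω (x, y) ∈ S') →
        c * N.P A ≤ N.P (A ∩ φ.jointStabilityEvent x y))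
    ⟨∅, subset_rfl, MeasurableSet.empty, 1, one_pos, fun x y t A _ h => by
      simp [eq_empty_of_forall_notMem (s := A) fun ω hω => h ω hω]⟩
    (fun S R hSR ⟨R', hR', h⟩ => ⟨R', hSR.trans hR', h⟩)
    (by
      rintro S R ⟨S', hS, hSm, c, hc, h⟩ ⟨R', hR, hRm, d, hd, h'⟩
      refine ⟨S' ∪ R', union_subset_union hS hR, hSm.union hRm, min c d, lt_min hc hd, ?_⟩
      intro x y t A hA hAmem
      have hB : MeasurableSet[N.filt t] {ω | φ.twoPointMotion t ω (x, y) ∈ S'} :=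
        φ.prod.measurable_map_apply t (x, y) hSm
      have hB' := N.filt.le t _ hB
      have h1 := h x y t _ (hA.inter hB) fun ω hω => hω.2
      have h2 := h' x y t _ (hA.diff hB) fun ω hω => (hAmem ω hω.1).resolve_left hω.2
      rw [inter_right_comm] at h1
      rw [sdiff_eq, inter_right_comm, ← sdiff_eq] at h2
      rw [← measure_inter_add_sdiff A hB',
        ← measure_inter_add_sdiff (A ∩ φ.jointStabilityEvent x y) hB', mul_add]
      exact add_le_add ((mul_le_mul_left (min_le_left c d) _).trans h1)
        ((mul_le_mul_left (min_le_right c d) _).trans h2))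
    (by
      rintro ⟨x₀, y₀⟩ -
      have hB := TopologicalSpace.isBasis_countableBasis X
      have hBc := TopologicalSpace.countable_countableBasis X
      obtain ⟨⟨U, V⟩, ⟨⟨hU, hxU⟩, hV, hyV⟩, hUV⟩ := exists_measure_pos_of_subset_biUnion
        ((hBc.mono (sep_subset _ _)).prod (hBc.mono (sep_subset _ _))) (hpos x₀ y₀)
        (φ.jointStabilityEvent_eq_biUnion x₀ y₀).subset
      have hUo := hB.isOpen hU
      have hVo := hB.isOpen hV
      refine ⟨U ×ˢ V, mem_nhdsWithin_of_mem_nhds (prod_mem_nhds (hUo.mem_nhds hxU)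
        (hVo.mem_nhds hyV)), U ×ˢ V, subset_rfl, hUo.measurableSet.prod hVo.measurableSet,
        _, hUV, fun x y t A hA hmem => ?_⟩
      rw [mul_comm, ← hN.measure_inter_preimage hA (φ.measurableSet_contracts _)]
      exact measure_mono fun ω hω => ⟨hω.1, mem_jointStabilityEvent_of_shift (hUo.union hVo) hω.2
        (Or.inl (hmem ω hω.1).1) (Or.inr (hmem ω hω.1).2)⟩)
  exact ⟨c, hc, fun x y t A hA => h x y t A hA fun ω _ => hS (mem_univ _)⟩

theorem isStablySynchronising_of_measure_jointStabilityEvent_pos (hN : N.IsMemoryless)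
    {φ : RDS N X} (hpos : ∀ x y, 0 < N.P (φ.jointStabilityEvent x y)) :
    φ.IsStablySynchronising := by
  obtain ⟨c, hc, h⟩ := exists_forall_mul_le_measure_inter_jointStabilityEvent hN hpos
  have hae : ∀ x y, ∀ᵐ ω ∂N.P, ω ∈ φ.jointStabilityEvent x y := fun x y =>
    N.measure_compl_eq_zero_of_le (φ.measurableSet_jointStabilityEvent x y) hc (h x y)
  refine ⟨fun x y => ?_, fun x => ?_⟩
  · filter_upwards [hae x y] with ω ⟨U, hU, hcontr⟩
    refine hcontr.mono ?_
    rintro _ (rfl | rfl)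
    exacts [mem_of_mem_nhds hU.1, mem_of_mem_nhds hU.2]
  · filter_upwards [hae x x] with ω ⟨U, hU, hcontr⟩
    exact ⟨U, hU.1, hcontr⟩

end Contraction

/-! ### Characterisation of stable synchronisation -/

section Characterisation

variable {T Ω X : Type*} [AddCommMonoid T] [LinearOrder T] [TopologicalSpace T]
  [MeasurableSpace Ω] [MetricSpace X] [CompactSpace X] [MeasurableSpace X] {N : NoiseSpace T Ω}

theorem IsSynchronising.eq_of_isMinimalSet {φ : RDS N X} (h : φ.IsSynchronising) {K K' : Set X}
    (hK : φ.IsMinimalSet K) (hK' : φ.IsMinimalSet K') : K' = K := by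
  have := N.isProbabilityMeasure
  suffices hne : (K ∩ K').Nonempty from
    (hK'.subset_of_inter_nonempty hK.2.1 hK.2.2.1 (inter_comm K K' ▸ hne)).antisymm
      (hK.subset_of_inter_nonempty hK'.2.1 hK'.2.2.1 hne)
  by_contra hne
  rw [not_nonempty_iff_eq_empty, ← disjoint_iff_inter_eq_empty] at hne
  obtain ⟨x, hx⟩ := hK.1
  obtain ⟨y, hy⟩ := hK'.1
  obtain ⟨δ, hδ, hdist⟩ := Metric.exists_pos_forall_lt_edist hK.2.1.isCompact hK'.2.1 hne
  obtain ⟨ω, h1, h2, h3⟩ := ((h x y).and (hK.2.2.1.and hK'.2.2.1)).exists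
  obtain ⟨s, hs⟩ := contracts_iff.1 h1 δ (NNReal.coe_pos.2 hδ)
  have := hdist _ (h2 s ⟨x, hx, rfl⟩) _ (h3 s ⟨y, hy, rfl⟩)
  rw [edist_nndist, ENNReal.coe_lt_coe] at this
  exact (hs s le_rfl x (by simp) y (by simp)).not_gt this

theorem IsSynchronising.isContractiblePair {φ : RDS N X} (h : φ.IsSynchronising) (x y : X) :
    φ.IsContractiblePair x y := by
  have := N.isProbabilityMeasure
  intro V hV hdiag
  have hVu : V ∈ uniformity X := by
    rw [← nhdsSet_diagonal_eq_uniformity]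
    exact hV.mem_nhdsSet.2 hdiag
  obtain ⟨ε, hε, hεV⟩ := Metric.mem_uniformity_dist.1 hVu
  have hae : ∀ᵐ ω ∂N.P, ∃ t, φ.twoPointMotion t ω (x, y) ∈ V := by
    filter_upwards [h x y] with ω hω
    obtain ⟨s, hs⟩ := contracts_iff.1 hω (ε / 2) (half_pos hε)
    exact ⟨s, hεV ((hs s le_rfl x (by simp) y (by simp)).trans_lt (half_lt_self hε))⟩
  exact pos_iff_ne_zero.2 (frequently_ae_iff.1 hae.frequently)

theorem isStablySynchronising_iff [Nonempty X] [BorelSpace X] [IsOrderedCancelAddMonoid T]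
    [CanonicallyOrderedAdd T] [CountableRightDense T] (hN : N.IsMemoryless) (φ : RDS N X) :
    φ.IsStablySynchronising ↔
      ∃ K : Set X, (φ.IsMinimalSet K ∧ ∀ K' : Set X, φ.IsMinimalSet K' → K' = K) ∧
        φ.IsTwoPointContractibleOn K ∧ φ.AdmitsStableTrajectories K := by
  have := N.isProbabilityMeasure
  constructor
  · rintro ⟨hsync, hstable⟩
    obtain ⟨K, -, hK⟩ := exists_isMinimalSet_subset univ_nonempty isClosed_univ
      φ.isForwardInvariant_univ
    refine ⟨K, ⟨hK, fun K' hK' => hsync.eq_of_isMinimalSet hK hK'⟩,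
      fun x _ y _ => hsync.isContractiblePair x y, ?_⟩
    obtain ⟨x, hx⟩ := hK.1
    have hae : ∀ᵐ ω ∂N.P, ∃ x ∈ K, φ.IsAsymptoticallyStable ω x := by
      filter_upwards [hstable x] with ω hω
      exact ⟨x, hx, hω⟩
    exact pos_iff_ne_zero.2 (frequently_ae_iff.1 hae.frequently)
  · rintro ⟨K, ⟨hK, huniq⟩, hcontr, hadm⟩
    obtain ⟨U, hU, hUK, hpos⟩ := exists_measure_contracts_pos hadm
    exact isStablySynchronising_of_measure_jointStabilityEvent_pos hN fun x y =>
      measure_jointStabilityEvent_pos hN hU hpos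
        (isAccessible_twoPointMotion_of_unique hN hK huniq hcontr hU hUK x y)

end Characterisation

end RDS

theorem theorem3p2p1 {Ω X : Type*} [MeasurableSpace Ω]
    [MetricSpace X] [CompactSpace X] [Nonempty X] [MeasurableSpace X] [BorelSpace X] :
    -- discrete time
    (∀ (N : NoiseSpace ℕ Ω), N.IsMemoryless → ∀ φ : RDS N X,
      (φ.IsStablySynchronising ↔
        ∃ K : Set X, (φ.IsMinimalSet K ∧ ∀ K' : Set X, φ.IsMinimalSet K' → K' = K) ∧
          φ.IsTwoPointContractibleOn K ∧ φ.AdmitsStableTrajectories K)) ∧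
    -- continuous time
    (∀ (N : NoiseSpace ℝ≥0 Ω), N.IsMemoryless → ∀ φ : RDS N X,
      (φ.IsStablySynchronising ↔
        ∃ K : Set X, (φ.IsMinimalSet K ∧ ∀ K' : Set X, φ.IsMinimalSet K' → K' = K) ∧
          φ.IsTwoPointContractibleOn K ∧ φ.AdmitsStableTrajectories K)) := by
  exact ⟨fun _ hN φ => RDS.isStablySynchronising_iff hN φ,
    fun _ hN φ => RDS.isStablySynchronising_iff hN φ⟩
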